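/- Let $K$ be a field of characteristic $0$, let $m\in K[x,y]$ be irreducible with $\tau_x=\deg_x m>0$ and $\tau_y=\deg_y m>0$, and let $a=\sum_{n\ge0}a_nx^n\in K[[x]]$ satisfy $m(x,a(x))=0$. We say that $a$ satisfies a linear differential equation of order $r$ and degree at most $d$ if there are $p_0,\dots,p_r\in K[x]$, all of degree at most $d$ and with $p_r\ne0$, such that $p_0a+p_1a'+\cdots+p_ra^{(r)}=0$. We say that $(a_n)_{n\ge0}$ satisfies a linear recurrence of order $s$ and degree at most $d$ if there are polynomials $q_0,\dots,q_s\in K[t]$, all of degree at most $d$ and with $q_s\neq0$, such that $q_0(n)a_n+q_1(n)a_{n+1}+\cdots+q_s(n)a_{n+s}=0$ for all integers $n\ge0$. Then: 1. The series $a$ satisfies a linear differential equation of order $\tau_y$ and degree at most $$2\tau_x\tau_y^2-\tfrac12\tau_y^2+\tau_x\tau_y-\tfrac32\tau_y+\tau_x+3.$$ 2. The series $a$ also satisfies a linear differential equation of order $2\tau_y$ and degree at most $$4\tau_x\tau_y-\tfrac12\tau_y-3\tau_x-1+\Bigl\lceil4\,\frac{\tau_x+1}{\tau_y+1}\Bigr\rceil.$$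 3. The coefficient sequence $(a_n)_{n\ge0}$ satisfies a linear recurrence of order $$\Bigl\lceil2\tau_x\tau_y+\tau_y-1+\sqrt{(8\tau_y^2-4\tau_y+4)\tau_x-2\tau_y^2-6\tau_y+12}\,\Bigr\rceil$$ and degree at most $$\Bigl\lceil\tau_y-1+\tfrac12\sqrt{(8\tau_y^2-4\tau_y+4)\tau_x-2\tau_y^2-6\tau_y+12}\,\Bigr\rceil.$$ -/

import Mathlib

open Polynomial
open scoped PowerSeries

noncomputable section

/-- `K[x,y]` is represented as `K[X][X]`: the outer variable is `y`, the inner one is `x`.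
The degree of `m` in `y` is `m.natDegree`; this is the degree of `m` in `x`, the largest degree
of a coefficient of a power of `y`. -/
def degX {K : Type*} [Field K] (m : K[X][X]) : ℕ :=
  m.support.sup fun j => (m.coeff j).natDegree

/-- `a ∈ K[[x]]` is a root of `m ∈ K[x,y]`, i.e. `m(x, a(x)) = 0`. -/
def IsSeriesRoot {K : Type*} [Field K] (m : K[X][X]) (a : K⟦X⟧) : Prop :=
  m.eval₂ (coeToPowerSeries.ringHom : K[X] →+* K⟦X⟧) a = 0

/-- `a` satisfies a linear differential equation
`p₀ a + p₁ a' + ⋯ + p_r a⁽ʳ⁾ = 0` of order `r` (so `p_r ≠ 0`)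
with polynomial coefficients `p_i ∈ K[x]` of degree at most `d`. -/
def SatisfiesLinearODE {K : Type*} [Field K] (a : K⟦X⟧) (r : ℕ) (d : ℝ) : Prop :=
  ∃ p : ℕ → K[X], p r ≠ 0 ∧ (∀ i ≤ r, ((p i).natDegree : ℝ) ≤ d) ∧
    ∑ i ∈ Finset.range (r + 1), (p i : K⟦X⟧) * (PowerSeries.derivative (R := K))^[i] a = 0

/-- The sequence `u` satisfies a linear recurrence
`q₀(n) u_n + q₁(n) u_{n+1} + ⋯ + q_s(n) u_{n+s} = 0` (for all `n ≥ 0`) of order `s`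
(so `q_s ≠ 0`) with polynomial coefficients `q_k` of degree at most `d`. -/
def SatisfiesLinearRecurrence {K : Type*} [Field K] (u : ℕ → K) (s : ℕ) (d : ℝ) : Prop :=
  ∃ q : ℕ → K[X], q s ≠ 0 ∧ (∀ k ≤ s, ((q k).natDegree : ℝ) ≤ d) ∧
    ∀ n : ℕ, ∑ k ∈ Finset.range (s + 1), (q k).eval (n : K) * u (n + k) = 0

end

/-! Let `α` be the image of the series in `F = Frac K⟦x⟧`. Irreducibility and characteristic 0 make
`α` a simple root of `m`, so `α` is the residue at `y = α` of `y m_y / m`, and `D α` is that of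
`-m_x / m`. Residues commute with `∂/∂x` and kill `y`-derivatives. Hence if `p₀ · y m_y / m + ∑ pᵢ₊₁
∂ₓⁱ(-m_x / m)` equals a `y`-derivative `-∂_y (G / m ^ ρ)`, then `∑ pᵢ Dⁱ α = 0`
(`sum_iterate_eq_zero_of_telescoper`).

Clearing the denominator `m ^ (ρ + 1)` turns this condition into a homogeneous linear system over
`K` for the coefficients of the `pᵢ` and of `G`. Once unknowns outnumber equations, a solution with
some `pᵢ ≠ 0` exists (`exists_telescoper`). The count is an inequality between order `r = ρ + 1` and
degree `d` (`satisfiesLinearODE_of_isSeriesRoot`). The two differential claims are its cases `r =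
τy` and `r = 2 τy`. An equation of order `r` and degree `d` yields a recurrence of order `r + d` and
degree `r`, so the third claim takes a point near the minimum of `r + d`. -/

/-- The derivation of `A[y]` applying a derivation of `A` to each coefficient. -/
noncomputable def Derivation.polyCoeffs {A : Type*} [CommRing A] (D : Derivation ℤ A A) :
    Derivation ℤ A[X] A[X] :=
  PolynomialModule.equivPolynomialSelf.compDer D.mapCoeffs

theorem Derivation.coeff_polyCoeffs {A : Type*} [CommRing A] (D : Derivation ℤ A A) (p : A[X])
    (i : ℕ) : (D.polyCoeffs p).coeff i = D (p.coeff i) := rfl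

theorem Derivation.polyCoeffs_C {A : Type*} [CommRing A] (D : Derivation ℤ A A) (a : A) :
    D.polyCoeffs (C a) = C (D a) := by
  ext i
  rw [D.coeff_polyCoeffs, coeff_C, coeff_C]
  split_ifs <;> simp

theorem Derivation.polyCoeffs_X {A : Type*} [CommRing A] (D : Derivation ℤ A A) :
    D.polyCoeffs X = 0 := by
  ext i
  rw [D.coeff_polyCoeffs, coeff_X]
  split_ifs <;> simp

/-- The derivation of `A⟦t⟧` applying a derivation of `A` to each coefficient. -/
noncomputable def Derivation.seriesCoeffs {A : Type*} [CommRing A] (D : Derivation ℤ A A) :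
    Derivation ℤ A⟦X⟧ A⟦X⟧ :=
  Derivation.mk'
    (AddMonoidHom.mk' (fun f => PowerSeries.mk fun n => D (PowerSeries.coeff n f))
      (fun f g => by ext n; simp)).toIntLinearMap
    (fun f g => by
      ext n
      change PowerSeries.coeff n (PowerSeries.mk fun k => D (PowerSeries.coeff k (f * g))) =
        PowerSeries.coeff n (f * (PowerSeries.mk fun k => D (PowerSeries.coeff k g)) +
          g * PowerSeries.mk fun k => D (PowerSeries.coeff k f))
      simp only [PowerSeries.coeff_mk, PowerSeries.coeff_mul,
        map_sum, Derivation.leibniz, smul_eq_mul, map_add, Finset.sum_add_distrib]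
      rw [← Finset.Nat.sum_antidiagonal_swap (f := fun p : ℕ × ℕ =>
        PowerSeries.coeff p.1 g * D (PowerSeries.coeff p.2 f))]
      rfl)

theorem Derivation.coeff_seriesCoeffs {A : Type*} [CommRing A] (D : Derivation ℤ A A) (f : A⟦X⟧)
    (n : ℕ) : PowerSeries.coeff n (D.seriesCoeffs f) = D (PowerSeries.coeff n f) :=
  PowerSeries.coeff_mk n fun k => D (PowerSeries.coeff k f)

theorem Derivation.seriesCoeffs_C {A : Type*} [CommRing A] (D : Derivation ℤ A A) (a : A) :
    D.seriesCoeffs (PowerSeries.C a) = PowerSeries.C (D a) := by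
  ext n
  rw [D.coeff_seriesCoeffs, PowerSeries.coeff_C, PowerSeries.coeff_C]
  split_ifs <;> simp

theorem Derivation.seriesCoeffs_X {A : Type*} [CommRing A] (D : Derivation ℤ A A) :
    D.seriesCoeffs (PowerSeries.X : A⟦X⟧) = 0 := by
  ext n
  rw [D.coeff_seriesCoeffs, PowerSeries.coeff_X]
  split_ifs <;> simp

/-- A numerator identity for the derivative of `N / M ^ n` when `M = t u` and `v = u⁻¹`. -/
theorem Derivation.mul_pow_of_eq_X_mul {A : Type*} [CommRing A] (Δ : Derivation ℤ A⟦X⟧ A⟦X⟧)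
    {u v : A⟦X⟧} (huv : u * v = 1) (N : A⟦X⟧) (n : ℕ) :
    (Δ N * (PowerSeries.X * u) - (n : A⟦X⟧) * N * Δ (PowerSeries.X * u)) * v ^ (n + 1) =
      PowerSeries.X * Δ (N * v ^ n) - (n : A⟦X⟧) * Δ PowerSeries.X * (N * v ^ n) := by
  have hv : Δ v = -v ^ 2 * Δ u := by
    simpa using Δ.leibniz_of_mul_eq_one (a := v) (b := u) (by rw [mul_comm, huv])
  have hvn : Δ (v ^ n) = -((n : A⟦X⟧) * v ^ (n + 1) * Δ u) := by
    rcases n with _ | n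
    · simp
    · rw [Δ.leibniz_pow, hv]
      simp only [Nat.add_sub_cancel, smul_eq_mul, nsmul_eq_mul]
      ring
  simp only [Derivation.leibniz, smul_eq_mul, hvn]
  have h1 : u * v ^ (n + 1) = v ^ n := by rw [pow_succ', ← mul_assoc, huv, one_mul]
  linear_combination (PowerSeries.X * Δ N - (n : A⟦X⟧) * N * Δ PowerSeries.X) * h1

/-! ### Residues of rational functions with powers of `m` as denominators -/

section Residue

variable {K F : Type*} [Field K] [Field F]

/-- The expansion of `N(x, y)` in powers of `t = y - α`. -/
noncomputable def expandAt (ψ : K[X] →+* F) (α : F) : K[X][X] →+* F⟦X⟧ :=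
  eval₂RingHom ((PowerSeries.C (R := F)).comp ψ) (PowerSeries.C α + PowerSeries.X)

/-- With `m = t u` and `v = u⁻¹`, this is the residue at `y = α` of `N / m ^ (i + 1)`. -/
noncomputable def residueAt (ψ : K[X] →+* F) (α : F) (v : F⟦X⟧) (i : ℕ) (N : K[X][X]) : F :=
  PowerSeries.coeff i (expandAt ψ α N * v ^ (i + 1))

theorem expandAt_C (ψ : K[X] →+* F) (α : F) (p : K[X]) :
    expandAt ψ α (C p) = PowerSeries.C (ψ p) := by
  simp [expandAt]

theorem expandAt_X (ψ : K[X] →+* F) (α : F) :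
    expandAt ψ α X = PowerSeries.C α + PowerSeries.X := by
  simp [expandAt]

theorem constantCoeff_expandAt (ψ : K[X] →+* F) (α : F) (N : K[X][X]) :
    PowerSeries.constantCoeff (expandAt ψ α N) = N.eval₂ ψ α := by
  have : (PowerSeries.constantCoeff (R := F)).comp (expandAt ψ α) = eval₂RingHom ψ α := by
    ext p <;> simp [expandAt_C, expandAt_X]
  exact congrArg (fun f : K[X][X] →+* F => f N) this

theorem expandAt_derivative (ψ : K[X] →+* F) (α : F) (N : K[X][X]) :
    expandAt ψ α (derivative N) = PowerSeries.derivative (R := F) (expandAt ψ α N) := by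
  induction N using Polynomial.induction_on' with
  | add p q hp hq => simp [hp, hq]
  | monomial n p =>
    rw [← C_mul_X_pow_eq_monomial]
    simp only [derivative_C_mul_X_pow, map_mul, map_pow, expandAt_C, expandAt_X, map_natCast,
      Derivation.leibniz, Derivation.leibniz_pow, smul_eq_mul, PowerSeries.derivative_C,
      PowerSeries.derivative_X, map_add, nsmul_eq_mul]
    ring

/-- The derivation with respect to `x` at constant `y`, in the coordinates `x` and `t = y - α`. -/
noncomputable def xDerivation (D : Derivation ℤ F F) (α : F) : Derivation ℤ F⟦X⟧ F⟦X⟧ :=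
  D.seriesCoeffs - PowerSeries.C (D α) • (PowerSeries.derivative (R := F)).restrictScalars ℤ

theorem xDerivation_apply (D : Derivation ℤ F F) (α : F) (f : F⟦X⟧) :
    xDerivation D α f = D.seriesCoeffs f - PowerSeries.C (D α) * PowerSeries.derivative (R := F) f := rfl

/-- `∂/∂x` on `K[x,y]`. -/
noncomputable def dX : Derivation ℤ K[X][X] K[X][X] :=
  ((Polynomial.derivative' (R := K)).restrictScalars ℤ).polyCoeffs

theorem coeff_dX (N : K[X][X]) (i : ℕ) : (dX N).coeff i = derivative (N.coeff i) := rfl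

variable {ψ : K[X] →+* F} {D : Derivation ℤ F F} (hD : ∀ p, D (ψ p) = ψ (derivative p)) {α : F}

include hD in
theorem expandAt_dX (N : K[X][X]) :
    expandAt ψ α (dX N) = xDerivation D α (expandAt ψ α N) := by
  induction N using Polynomial.induction_on' with
  | add p q hp hq => simp [hp, hq]
  | monomial n p =>
    have h1 : xDerivation D α (PowerSeries.C α + PowerSeries.X) = 0 := by
      simp [xDerivation_apply, Derivation.seriesCoeffs_C, Derivation.seriesCoeffs_X]
    have h2 : xDerivation D α (PowerSeries.C (ψ p)) = PowerSeries.C (ψ (derivative p)) := by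
      simp [xDerivation_apply, Derivation.seriesCoeffs_C, hD]
    have h3 : dX (X : K[X][X]) = 0 := Derivation.polyCoeffs_X _
    have h4 : dX (C p : K[X][X]) = C (derivative p) := Derivation.polyCoeffs_C _ _
    rw [← C_mul_X_pow_eq_monomial]
    simp only [map_mul, map_pow, expandAt_C, expandAt_X, Derivation.leibniz,
      Derivation.leibniz_pow, h1, h2, h3, h4, smul_zero, smul_eq_mul, mul_zero, zero_add, map_mul, map_pow]

variable {m : K[X][X]} {u v : F⟦X⟧} (hm : expandAt ψ α m = PowerSeries.X * u) (huv : u * v = 1)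

include hm huv

theorem residueAt_mul (i : ℕ) (N : K[X][X]) :
    residueAt ψ α v (i + 1) (N * m) = residueAt ψ α v i N := by
  have : expandAt ψ α (N * m) * v ^ (i + 1 + 1) =
      PowerSeries.X * (expandAt ψ α N * v ^ (i + 1)) := by
    rw [map_mul, hm]
    linear_combination expandAt ψ α N * PowerSeries.X * v ^ (i + 1) * huv
  rw [residueAt, this, PowerSeries.coeff_succ_X_mul, residueAt]

theorem residueAt_mul_pow (i k : ℕ) (N : K[X][X]) :
    residueAt ψ α v (i + k) (N * m ^ k) = residueAt ψ α v i N := by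
  induction k with
  | zero => simp
  | succ k ih => rw [pow_succ, ← mul_assoc, ← add_assoc, residueAt_mul hm huv, ih]

/-- The numerator is that of `∂_y (N / m ^ n)`, and the derivative of a Laurent series in `t` has no
`t⁻¹` term. -/
theorem residueAt_derivative (n : ℕ) (N : K[X][X]) :
    residueAt ψ α v n (derivative N * m - (n : K[X][X]) * N * derivative m) = 0 := by
  have := ((PowerSeries.derivative (R := F)).restrictScalars ℤ).mul_pow_of_eq_X_mul huv
    (expandAt ψ α N) n
  rw [← hm] at this
  simp only [Derivation.restrictScalars_apply, ← expandAt_derivative, PowerSeries.derivative_X,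
    mul_one] at this
  rw [residueAt, map_sub, (expandAt ψ α).map_mul, (expandAt ψ α).map_mul, (expandAt ψ α).map_mul,
    map_natCast, this, map_sub,
    ← map_natCast (PowerSeries.C (R := F)), PowerSeries.coeff_C_mul]
  rcases n with _ | n
  · simp
  · rw [PowerSeries.coeff_succ_X_mul, PowerSeries.coeff_derivative]
    push_cast
    ring

include hD

/-- The residue commutes with differentiation in `x`: at constant `y` this is `D` on coefficients
minus `D α · ∂_t`, and the second part has residue zero. -/
theorem residueAt_dX (i : ℕ) (N : K[X][X]) :
    residueAt ψ α v (i + 1) (dX N * m - ((i + 1 : ℕ) : K[X][X]) * N * dX m) = D (residueAt ψ α v i N) := by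
  have := (xDerivation D α).mul_pow_of_eq_X_mul huv (expandAt ψ α N) (i + 1)
  have hX : xDerivation D α PowerSeries.X = - PowerSeries.C (D α) := by
    simp [xDerivation_apply, Derivation.seriesCoeffs_X]
  rw [← hm, ← expandAt_dX hD, ← expandAt_dX hD, hX] at this
  rw [residueAt, map_sub, (expandAt ψ α).map_mul, (expandAt ψ α).map_mul, (expandAt ψ α).map_mul,
    map_natCast, this, map_sub,
    ← map_natCast (PowerSeries.C (R := F)), PowerSeries.coeff_succ_X_mul, ← map_neg,
    ← map_mul, PowerSeries.coeff_C_mul, xDerivation_apply, map_sub, PowerSeries.coeff_C_mul,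
    PowerSeries.coeff_derivative, D.coeff_seriesCoeffs, residueAt]
  push_cast
  ring

theorem residueAt_neg_dX : residueAt ψ α v 0 (-dX m) = D α := by
  have huv' := congrArg (PowerSeries.constantCoeff (R := F)) huv
  rw [map_mul, map_one] at huv'
  rw [residueAt, map_neg, expandAt_dX hD, hm, xDerivation_apply, Derivation.leibniz,
    Derivation.leibniz, Derivation.seriesCoeffs_X]
  simp
  linear_combination D α * huv'

omit hD in
theorem residueAt_X_mul_derivative : residueAt ψ α v 0 (X * derivative m) = α := by
  have huv' := congrArg (PowerSeries.constantCoeff (R := F)) huv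
  rw [map_mul, map_one] at huv'
  rw [residueAt, (expandAt ψ α).map_mul, expandAt_derivative, hm, expandAt_X, Derivation.leibniz]
  simp
  linear_combination α * huv'

end Residue

/-- Numerators over `m ^ (i + 1)` of the `i`-th `x`-derivative of `-m_x / m`. -/
noncomputable def derivNumerator {K : Type*} [Field K] (m : K[X][X]) : ℕ → K[X][X]
  | 0 => -dX m
  | i + 1 => dX (derivNumerator m i) * m - ((i + 1 : ℕ) : K[X][X]) * derivNumerator m i * dX m

theorem residueAt_derivNumerator {K F : Type*} [Field K] [Field F] {ψ : K[X] →+* F}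
    {D : Derivation ℤ F F} (hD : ∀ p, D (ψ p) = ψ (derivative p)) {α : F}
    {m : K[X][X]} {u v : F⟦X⟧} (hm : expandAt ψ α m = PowerSeries.X * u) (huv : u * v = 1)
    (i : ℕ) : residueAt ψ α v i (derivNumerator m i) = D^[i + 1] α := by
  induction i with
  | zero => exact residueAt_neg_dX hD hm huv
  | succ i ih =>
    rw [Function.iterate_succ_apply', ← ih, derivNumerator, residueAt_dX hD hm huv]

theorem residueAt_C_mul {K F : Type*} [Field K] [Field F] (ψ : K[X] →+* F) (α : F) (v : F⟦X⟧)
    (i : ℕ) (p : K[X]) (N : K[X][X]) :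
    residueAt ψ α v i (C p * N) = ψ p * residueAt ψ α v i N := by
  rw [residueAt, (expandAt ψ α).map_mul, expandAt_C, mul_assoc, PowerSeries.coeff_C_mul, residueAt]

theorem residueAt_add {K F : Type*} [Field K] [Field F] (ψ : K[X] →+* F) (α : F) (v : F⟦X⟧)
    (i : ℕ) (M N : K[X][X]) :
    residueAt ψ α v i (M + N) = residueAt ψ α v i M + residueAt ψ α v i N := by
  rw [residueAt, map_add, add_mul, map_add, residueAt, residueAt]

theorem residueAt_sum {K F ι : Type*} [Field K] [Field F] (ψ : K[X] →+* F) (α : F) (v : F⟦X⟧)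
    (i : ℕ) (s : Finset ι) (N : ι → K[X][X]) :
    residueAt ψ α v i (∑ j ∈ s, N j) = ∑ j ∈ s, residueAt ψ α v i (N j) := by
  simp only [residueAt, map_sum, Finset.sum_mul]

/-- The operator `p₀ + p₁ D + ⋯` acting on `α` vanishes as soon as the corresponding rational
function is a `y`-derivative. -/
theorem sum_iterate_eq_zero_of_telescoper {K F : Type*} [Field K] [Field F] {ψ : K[X] →+* F}
    {D : Derivation ℤ F F} (hD : ∀ p, D (ψ p) = ψ (derivative p)) {α : F}
    {m : K[X][X]} (h0 : m.eval₂ ψ α = 0) (h1 : (derivative m).eval₂ ψ α ≠ 0)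
    (ρ : ℕ) (p : ℕ → K[X]) (G : K[X][X])
    (hG : C (p 0) * (X * derivative m * m ^ ρ) +
      ∑ i ∈ Finset.range (ρ + 1), C (p (i + 1)) * (derivNumerator m i * m ^ (ρ - i)) +
      (derivative G * m - (ρ : K[X][X]) * G * derivative m) = 0) :
    ∑ i ∈ Finset.range (ρ + 2), ψ (p i) * D^[i] α = 0 := by
  obtain ⟨u, hu⟩ : PowerSeries.X ∣ expandAt ψ α m := by
    rw [PowerSeries.X_dvd_iff, constantCoeff_expandAt, h0]
  -- The constant term of `u` is `m_y(α)`. It is invertible because `F` is a field; in `K⟦x⟧` it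
  -- need not be a unit.
  have hu0 : PowerSeries.constantCoeff u ≠ 0 := by
    rw [← constantCoeff_expandAt, expandAt_derivative, hu, Derivation.leibniz] at h1
    simpa using h1
  have huv : u * u⁻¹ = 1 := PowerSeries.mul_inv_cancel u hu0
  have key := congrArg (residueAt ψ α u⁻¹ ρ) hG
  have hz : residueAt ψ α u⁻¹ ρ (0 : K[X][X]) = 0 := by simp [residueAt]
  rw [residueAt_add, residueAt_add, residueAt_derivative hu huv, hz, add_zero, residueAt_sum,
    residueAt_C_mul] at key
  have hp0 := residueAt_mul_pow hu huv 0 ρ (X * derivative m)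
  rw [zero_add, residueAt_X_mul_derivative hu huv] at hp0
  rw [hp0] at key
  rw [Finset.sum_range_succ', add_comm, Function.iterate_zero, id, ← key]
  congr 1
  refine Finset.sum_congr rfl fun i hi => ?_
  rw [residueAt_C_mul]
  have := residueAt_mul_pow hu huv i (ρ - i) (derivNumerator m i)
  rw [Nat.add_sub_cancel' (by simpa [Nat.lt_succ_iff] using hi)] at this
  rw [this, residueAt_derivNumerator hD hu huv]

/-! ### Bidegree bounds and dimension counting -/

/-- Every monomial `x ^ l * y ^ j` of `N` satisfies `l ≤ a` and `j ≤ b`. -/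
def BidegreeLE {K : Type*} [Field K] (N : K[X][X]) (a b : ℤ) : Prop :=
  ∀ j l : ℕ, (N.coeff j).coeff l ≠ 0 → (l : ℤ) ≤ a ∧ (j : ℤ) ≤ b

namespace BidegreeLE

variable {K : Type*} [Field K] {M N : K[X][X]} {a b a' b' : ℤ}

theorem mono (h : BidegreeLE N a b) (ha : a ≤ a') (hb : b ≤ b') : BidegreeLE N a' b' :=
  fun j l hjl => ⟨(h j l hjl).1.trans ha, (h j l hjl).2.trans hb⟩

theorem zero : BidegreeLE (0 : K[X][X]) a b := fun j l h => by simp at h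

theorem add (hM : BidegreeLE M a b) (hN : BidegreeLE N a b) : BidegreeLE (M + N) a b := by
  intro j l h
  rw [coeff_add, coeff_add] at h
  by_cases hM0 : (M.coeff j).coeff l = 0
  · exact hN j l fun h0 => h (by rw [hM0, h0, add_zero])
  · exact hM j l hM0

theorem neg (hN : BidegreeLE N a b) : BidegreeLE (-N) a b := fun j l h =>
  hN j l (by simpa using h)

theorem sub (hM : BidegreeLE M a b) (hN : BidegreeLE N a b) : BidegreeLE (M - N) a b := by
  rw [sub_eq_add_neg]
  exact hM.add hN.neg

theorem sum {ι : Type*} {s : Finset ι} {f : ι → K[X][X]} (h : ∀ i ∈ s, BidegreeLE (f i) a b) :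
    BidegreeLE (∑ i ∈ s, f i) a b :=
  Finset.sum_induction f (BidegreeLE · a b) (fun _ _ => add) zero h

theorem mul (hM : BidegreeLE M a b) (hN : BidegreeLE N a' b') :
    BidegreeLE (M * N) (a + a') (b + b') := by
  intro j l h
  rw [coeff_mul, finsetSum_coeff] at h
  obtain ⟨⟨j₁, j₂⟩, hj, h⟩ := Finset.exists_ne_zero_of_sum_ne_zero h
  rw [coeff_mul] at h
  obtain ⟨⟨l₁, l₂⟩, hl, h⟩ := Finset.exists_ne_zero_of_sum_ne_zero h
  rw [Finset.HasAntidiagonal.mem_antidiagonal] at hj hl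
  have h1 := hM _ _ (left_ne_zero_of_mul h)
  have h2 := hN _ _ (right_ne_zero_of_mul h)
  simp only at hj hl h1 h2
  omega

theorem C {p : K[X]} {n : ℕ} (hp : p.natDegree ≤ n) : BidegreeLE (Polynomial.C p) n 0 := by
  intro j l h
  rw [coeff_C] at h
  split_ifs at h with hj
  · have := le_natDegree_of_ne_zero h
    omega
  · simp at h

theorem natCast (n : ℕ) : BidegreeLE (n : K[X][X]) 0 0 := by
  have := C (K := K) (p := (n : K[X])) (n := 0) (by simp)
  simpa using this

theorem X : BidegreeLE (X : K[X][X]) 0 1 := by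
  intro j l h
  rw [coeff_X] at h
  split_ifs at h with hj
  · have := le_natDegree_of_ne_zero h
    rw [natDegree_one] at this
    omega
  · simp at h

theorem pow (hM : BidegreeLE M a b) (n : ℕ) : BidegreeLE (M ^ n) (n * a) (n * b) := by
  induction n with
  | zero => simpa using natCast (K := K) 1
  | succ n ih =>
    rw [pow_succ]
    exact (ih.mul hM).mono (by push_cast; linarith) (by push_cast; linarith)

theorem derivative (hM : BidegreeLE M a b) : BidegreeLE (derivative M) a (b - 1) := by
  intro j l h
  rw [coeff_derivative, ← Nat.cast_succ, ← C_eq_natCast, coeff_mul_C] at h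
  have := hM _ _ (left_ne_zero_of_mul h)
  push_cast at this
  omega

theorem dX (hM : BidegreeLE M a b) : BidegreeLE (dX M) (a - 1) b := by
  intro j l h
  rw [coeff_dX, coeff_derivative] at h
  have := hM _ _ (left_ne_zero_of_mul h)
  push_cast at this
  omega

theorem of_degX (m : K[X][X]) : BidegreeLE m (degX m) m.natDegree := by
  intro j l h
  have hj : m.coeff j ≠ 0 := fun h0 => h (by rw [h0, coeff_zero])
  have h1 := le_natDegree_of_ne_zero h
  have h2 : (m.coeff j).natDegree ≤ degX m :=
    Finset.le_sup (f := fun j => (m.coeff j).natDegree) (mem_support_iff.2 hj)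
  have h3 := le_natDegree_of_ne_zero hj
  omega

/-- Each step multiplies by one more `m` but also differentiates once in `x`. The saving of one
`x`-degree per derivative later allows larger `pᵢ`. -/
theorem derivNumerator {m : K[X][X]} (hm : BidegreeLE m a b) (i : ℕ) :
    BidegreeLE (derivNumerator m i) ((i + 1) * (a - 1)) ((i + 1) * b) := by
  induction i with
  | zero => exact hm.dX.neg.mono (by simp) (by simp)
  | succ i ih =>
    rw [_root_.derivNumerator]
    refine ((ih.dX.mul hm).mono ?_ ?_).sub ((((natCast (i + 1)).mul ih).mul hm.dX).mono ?_ ?_) <;>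
    · push_cast
      linarith

end BidegreeLE

theorem exists_ne_zero_of_bidegree {K V : Type*} [Field K] [AddCommGroup V] [Module K V]
    [FiniteDimensional K V] (T : V →ₗ[K] K[X][X]) {a b : ℕ} (hT : ∀ v, BidegreeLE (T v) a b)
    (h : (b + 1) * (a + 1) < Module.finrank K V) : ∃ v ≠ 0, T v = 0 := by
  let L : V →ₗ[K] (Fin (b + 1) × Fin (a + 1) → K) := LinearMap.pi fun q =>
    lcoeff K q.2 ∘ₗ (lcoeff K[X] q.1).restrictScalars K ∘ₗ T
  have hL : L.ker ≠ ⊥ := L.ker_ne_bot_of_finrank_lt (by simpa using h)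
  obtain ⟨v, hv, hv0⟩ := (Submodule.ne_bot_iff _).1 hL
  refine ⟨v, hv0, ?_⟩
  ext j l
  by_contra hjl
  have hb := hT v j l hjl
  have := congrFun (LinearMap.mem_ker.1 hv) (⟨j, by omega⟩, ⟨l, by omega⟩)
  exact hjl this

/-- The hypothesis says that `G / m ^ ρ` has zero derivative. Comparing the coefficients of top
formal degree gives the claim in characteristic 0. -/
theorem natDegree_eq_of_derivative_mul_eq {R : Type*} [CommRing R] [IsDomain R] [CharZero R]
    {G m : R[X]} {ρ : ℕ} (hG : G ≠ 0) (hm : m ≠ 0)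
    (h : derivative G * m = (ρ : R[X]) * G * derivative m) :
    G.natDegree = ρ * m.natDegree := by
  have hc := congrArg leadingCoeff h
  rw [leadingCoeff_mul, leadingCoeff_mul, leadingCoeff_mul, leadingCoeff_derivative,
    leadingCoeff_derivative, ← C_eq_natCast, leadingCoeff_C] at hc
  have h0 : G.leadingCoeff * m.leadingCoeff ≠ 0 :=
    mul_ne_zero (leadingCoeff_ne_zero.2 hG) (leadingCoeff_ne_zero.2 hm)
  have : (G.natDegree : R) = ((ρ * m.natDegree : ℕ) : R) := by
    push_cast
    refine mul_right_cancel₀ h0 ?_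
    linear_combination hc
  exact_mod_cast this

theorem finrank_degreeLT {K : Type*} [Field K] (n : ℕ) :
    Module.finrank K (degreeLT K n) = n := by
  rw [(degreeLTEquiv K n).finrank_eq, Module.finrank_fin_fun]

instance {K : Type*} [Field K] (n : ℕ) : FiniteDimensional K (degreeLT K n) :=
  (degreeLTEquiv K n).symm.finiteDimensional

theorem two_mul_sum_range_sub {k n : ℕ} (h : k ≤ n) :
    2 * ∑ i ∈ Finset.range n, (k - i) = k * (k + 1) := by
  have h1 : ∑ i ∈ Finset.range n, (k - i) = ∑ i ∈ Finset.range k, (k - i) := by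
    symm
    refine Finset.sum_subset (Finset.range_mono h) fun i _ hi => ?_
    rw [Finset.mem_range] at hi
    omega
  have h2 := Finset.sum_range_reflect (fun i => i + 1) k
  have h3 := Finset.sum_range_id_mul_two (k + 1)
  rw [Finset.sum_range_succ'] at h3
  rw [h1, mul_comm, ← Nat.add_sub_cancel k 1, mul_comm (k + 1 - 1), Nat.add_sub_cancel k 1]
  rw [add_zero, Nat.add_sub_cancel, mul_comm (k + 1)] at h3
  rw [mul_comm (k + 1), ← h3, ← h2]
  congr 1
  refine Finset.sum_congr rfl fun i hi => ?_
  rw [Finset.mem_range] at hi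
  omega

/-! ### Existence of telescopers by linear algebra -/

section Telescoper

variable {K : Type*} [Field K]

/-- The numerators over `m ^ (ρ + 1)` of rational functions with residues `α, D α, D² α, …`. -/
noncomputable def telescoperBasis (m : K[X][X]) (ρ : ℕ) : ℕ → K[X][X]
  | 0 => X * derivative m * m ^ ρ
  | i + 1 => derivNumerator m i * m ^ (ρ - i)

/-- The numerator over `m ^ (ρ + 1)` of `∑ pᵢ Dⁱ` applied to a rational function with residue `α`,
plus a `y`-derivative. -/
noncomputable def telescoperMap (m : K[X][X]) (ρ : ℕ) (n : ℕ → ℕ) (S : Finset ℕ) (g : ℕ) :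
    ((∀ i : Fin (ρ + 2), degreeLT K (n i)) × (S → degreeLT K g)) →ₗ[K] K[X][X] where
  toFun v := ∑ i, C (v.1 i : K[X]) * telescoperBasis m ρ i +
    (derivative (∑ j, C (v.2 j : K[X]) * X ^ (j : ℕ)) * m -
      (ρ : K[X][X]) * (∑ j, C (v.2 j : K[X]) * X ^ (j : ℕ)) * derivative m)
  map_add' v w := by
    simp only [Prod.fst_add, Prod.snd_add, Pi.add_apply, Submodule.coe_add, C_add, add_mul,
      Finset.sum_add_distrib, derivative_add]
    ring
  map_smul' c v := by
    simp only [Prod.smul_fst, Prod.smul_snd, Pi.smul_apply, Submodule.coe_smul, ← smul_C,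
      smul_mul_assoc, ← Finset.smul_sum, derivative_smul, mul_smul_comm, RingHom.id_apply,
      smul_add, smul_sub]

theorem telescoperMap_apply (m : K[X][X]) (ρ : ℕ) (n : ℕ → ℕ) (S : Finset ℕ) (g : ℕ)
    (v : (∀ i : Fin (ρ + 2), degreeLT K (n i)) × (S → degreeLT K g)) :
    telescoperMap m ρ n S g v = ∑ i, C (v.1 i : K[X]) * telescoperBasis m ρ i +
      (derivative (∑ j, C (v.2 j : K[X]) * X ^ (j : ℕ)) * m -
        (ρ : K[X][X]) * (∑ j, C (v.2 j : K[X]) * X ^ (j : ℕ)) * derivative m) := rfl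

theorem natDegree_le_of_mem_degreeLT {p : K[X]} {n : ℕ} (hp : p ∈ degreeLT K (n + 1)) :
    p.natDegree ≤ n :=
  natDegree_le_iff_coeff_eq_zero.2 fun i hi =>
    (degree_lt_iff_coeff_zero p (n + 1)).1 (mem_degreeLT.1 hp) i hi

theorem bidegreeLE_telescoperBasis {m : K[X][X]} {a b : ℕ} (hm : BidegreeLE m a b) {ρ i : ℕ}
    (hi : i ≤ ρ + 1) :
    BidegreeLE (telescoperBasis m ρ i) ((ρ + 1) * a - i) ((ρ + 1) * b) := by
  rcases i with _ | i
  · refine (((BidegreeLE.X.mul hm.derivative).mul (hm.pow ρ))).mono ?_ ?_ <;>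
    · push_cast
      linarith
  · have : ((ρ - i : ℕ) : ℤ) = ρ - i := by omega
    refine ((hm.derivNumerator i).mul (hm.pow (ρ - i))).mono ?_ ?_ <;>
    · rw [this]
      push_cast
      linarith

/-- Since the `i`-th basis numerator has `x`-degree at most `(ρ + 1) a - i`, the polynomial `pᵢ` may
have degree up to `e + min i k` without enlarging the target. -/
theorem bidegreeLE_telescoperMap {m : K[X][X]} {a b : ℕ} (hm : BidegreeLE m a b) {ρ e k : ℕ}
    {S : Finset ℕ} (hS : ∀ j ∈ S, j ≤ ρ * b + 1)
    (v : (∀ i : Fin (ρ + 2), degreeLT K (e + k + 1 - (k - i))) ×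
      (S → degreeLT K (e + ρ * a + 1))) :
    BidegreeLE (telescoperMap m ρ (fun i => e + k + 1 - (k - i)) S (e + ρ * a + 1) v)
      (e + (ρ + 1) * a : ℕ) ((ρ + 1) * b : ℕ) := by
  have hG : BidegreeLE (∑ j, C (v.2 j : K[X]) * X ^ (j : ℕ)) (e + ρ * a : ℕ) (ρ * b + 1 : ℕ) := by
    refine BidegreeLE.sum fun j _ => ?_
    have := hS j j.2
    refine ((BidegreeLE.C (natDegree_le_of_mem_degreeLT (v.2 j).2)).mul
      (BidegreeLE.X.pow j)).mono ?_ ?_ <;>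
    · push_cast
      zify at this
      linarith
  refine BidegreeLE.add (BidegreeLE.sum fun i _ => ?_) (BidegreeLE.sub ?_ ?_)
  · have hi := i.2
    have h1 : e + k + 1 - (k - (i : ℕ)) = (e + k - (k - i)) + 1 := by omega
    have h2 := (v.1 i).2
    simp only [h1] at h2
    have h3 : ((e + k - (k - i) : ℕ) : ℤ) ≤ e + i := by omega
    refine ((BidegreeLE.C (natDegree_le_of_mem_degreeLT h2)).mul
      (bidegreeLE_telescoperBasis hm (by omega))).mono ?_ ?_ <;>
    · push_cast
      linarith
  · refine (hG.derivative.mul hm).mono ?_ ?_ <;>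
    · push_cast
      linarith
  · refine (((BidegreeLE.natCast ρ).mul hG).mul hm.derivative).mono ?_ ?_ <;>
    · push_cast
      linarith

theorem telescoperMap_apply_mk (m : K[X][X]) (ρ : ℕ) (n : ℕ → ℕ) (S : Finset ℕ) (g : ℕ)
    (p : ∀ i : Fin (ρ + 2), degreeLT K (n i)) (w : S → degreeLT K g) :
    telescoperMap m ρ n S g (p, w) = C (p 0 : K[X]) * (X * derivative m * m ^ ρ) +
      ∑ i : Fin (ρ + 1), C (p i.succ : K[X]) * (derivNumerator m i * m ^ (ρ - i)) +
      (derivative (∑ j, C (w j : K[X]) * X ^ (j : ℕ)) * m -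
        (ρ : K[X][X]) * (∑ j, C (w j : K[X]) * X ^ (j : ℕ)) * derivative m) := by
  rw [telescoperMap_apply, Fin.sum_univ_succ]
  rfl

/-- A nonzero `G` with `G / m ^ ρ` constant in `y` has `y`-degree exactly `ρ · deg m`. Forbidding
that one exponent makes the `G`-part injective, so a nonzero solution must have a nonzero `pᵢ`. -/
theorem eq_zero_of_telescoperMap_zero_mk [CharZero K] {m : K[X][X]} (hm0 : m ≠ 0) {ρ g : ℕ}
    {n : ℕ → ℕ} {S : Finset ℕ} (hS : ρ * m.natDegree ∉ S) (w : S → degreeLT K g)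
    (h : telescoperMap m ρ n S g (0, w) = 0) : w = 0 := by
  have hcoeff : ∀ i, (∑ j, C (w j : K[X]) * X ^ (j : ℕ)).coeff i =
      if h : i ∈ S then (w ⟨i, h⟩ : K[X]) else 0 := by
    intro i
    rw [finsetSum_coeff]
    simp only [coeff_C_mul_X_pow]
    split_ifs with h
    · rw [Finset.sum_eq_single ⟨i, h⟩]
      · simp
      · intro j _ hj
        rw [if_neg]
        rintro rfl
        exact hj rfl
      · simp
    · refine Finset.sum_eq_zero fun j _ => if_neg ?_
      rintro rfl
      exact h j.2
  rw [telescoperMap_apply_mk] at h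
  generalize (∑ j, C (w j : K[X]) * X ^ (j : ℕ)) = G at *
  have hT : derivative G * m = (ρ : K[X][X]) * G * derivative m := by
    simpa [sub_eq_zero] using h
  have hG0 : G = 0 := by
    by_contra hG0
    have hlead := hcoeff G.natDegree
    rw [natDegree_eq_of_derivative_mul_eq hG0 hm0 hT, dif_neg hS,
      ← natDegree_eq_of_derivative_mul_eq hG0 hm0 hT] at hlead
    exact hG0 (leadingCoeff_eq_zero.1 hlead)
  ext1 j
  have := hcoeff j
  rw [hG0, coeff_zero, dif_pos j.2] at this
  exact Subtype.ext this.symm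

/-- There are `((ρ + 1) b + 1)(e + (ρ + 1) a + 1)` equations, and `G` supplies `(ρ b + 1)(e + ρ a +
1)` unknowns. For fixed `d = e + k`, capping the extra degrees at `k = b` maximises the surplus,
whose gain is `b k - k (k + 1) / 2`. -/
theorem exists_telescoperMap_eq_zero {m : K[X][X]} {a b : ℕ} (hm : BidegreeLE m a b) {ρ e : ℕ}
    {S : Finset ℕ} (hScard : S.card = ρ * b + 1) (hS : ∀ j ∈ S, j ≤ ρ * b + 1) (hρ : b ≤ ρ + 1)
    (hcount : 2 * a * (b * (2 * ρ + 1) + 1) < 2 * (ρ + 2 - b) * (e + b + 1) + b * (b - 1)) :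
    ∃ v ≠ 0, telescoperMap m ρ (fun i => e + b + 1 - (b - i)) S (e + ρ * a + 1) v = 0 := by
  refine exists_ne_zero_of_bidegree _ (bidegreeLE_telescoperMap hm hS) ?_
  have hsum : ∑ i : Fin (ρ + 2), (e + b + 1 - (b - i)) + ∑ i ∈ Finset.range (ρ + 2), (b - i) =
      (ρ + 2) * (e + b + 1) := by
    rw [Fin.sum_univ_eq_sum_range (fun i => e + b + 1 - (b - i)), ← Finset.sum_add_distrib,
      Finset.sum_congr rfl (g := fun _ => e + b + 1) (fun i _ => by omega)]
    simp
  have h2 := two_mul_sum_range_sub (k := b) (n := ρ + 2) (by omega)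
  rw [Module.finrank_prod, Module.finrank_pi_fintype, Module.finrank_pi_fintype]
  simp only [finrank_degreeLT, Finset.sum_const, Finset.card_univ, Fintype.card_coe, hScard,
    smul_eq_mul]
  generalize ∑ i : Fin (ρ + 2), (e + b + 1 - (b - i)) = s1 at *
  generalize ∑ i ∈ Finset.range (ρ + 2), (b - i) = s2 at *
  have h3 : ((ρ + 2 - b : ℕ) : ℤ) = ρ + 2 - b := by omega
  have h4 : ((b * (b - 1) : ℕ) : ℤ) = b * (b - 1) := by
    rcases b with _ | b <;> simp
  zify at hsum h2 hcount ⊢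
  rw [h3] at hcount
  push_cast at h4
  rw [h4] at hcount
  linarith

/-- A nonzero operator `p₀ + p₁ D + ⋯` of order at most `ρ + 1` and degree at most `d`, whose
associated rational function is a `y`-derivative. -/
theorem exists_telescoper [CharZero K] {m : K[X][X]} {a b : ℕ} (ha : a = degX m)
    (hb : b = m.natDegree) (hm0 : m ≠ 0) {ρ d : ℕ} (hρ : b ≤ ρ + 1) (hd : b ≤ d)
    (hcount : 2 * a * (b * (2 * ρ + 1) + 1) < 2 * (ρ + 2 - b) * (d + 1) + b * (b - 1)) :
    ∃ (p : ℕ → K[X]) (G : K[X][X]), (∃ i ≤ ρ + 1, p i ≠ 0) ∧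
      (∀ i ≤ ρ + 1, (p i).natDegree ≤ d) ∧
      C (p 0) * (X * derivative m * m ^ ρ) +
        ∑ i ∈ Finset.range (ρ + 1), C (p (i + 1)) * (derivNumerator m i * m ^ (ρ - i)) +
        (derivative G * m - (ρ : K[X][X]) * G * derivative m) = 0 := by
  have hm : BidegreeLE m a b := by
    rw [ha, hb]
    exact BidegreeLE.of_degX m
  obtain ⟨e, rfl⟩ := Nat.exists_eq_add_of_le' hd
  obtain ⟨⟨q, w⟩, hv0, hv⟩ := exists_telescoperMap_eq_zero hm
    (S := (Finset.range (ρ * b + 2)).erase (ρ * b))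
    (by rw [Finset.card_erase_of_mem (by simp), Finset.card_range]; omega)
    (fun j hj => by
      have := Finset.mem_range.1 (Finset.mem_of_mem_erase hj)
      omega) hρ hcount
  refine ⟨fun i => if h : i < ρ + 2 then q ⟨i, h⟩ else 0,
    ∑ j, C (w j : K[X]) * X ^ (j : ℕ), ?_, fun i hi => ?_, ?_⟩
  · by_contra! hp
    have hq : q = 0 := by
      ext1 i
      have := hp i (by omega)
      simp only [i.2, dif_pos] at this
      exact Subtype.ext this
    rw [hq] at hv
    have hw := eq_zero_of_telescoperMap_zero_mk hm0 (by simp [hb]) w hv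
    exact hv0 (by rw [hq, hw]; rfl)
  · have hi' : i < ρ + 2 := by omega
    simp only [hi', dif_pos]
    have h1 : e + b + 1 - (b - i) = (e + b - (b - i)) + 1 := by omega
    have h2 := (q ⟨i, hi'⟩).2
    simp only [h1] at h2
    exact (natDegree_le_of_mem_degreeLT h2).trans (by omega)
  · rw [telescoperMap_apply_mk] at hv
    rw [Finset.sum_range, ← hv]
    congr 2
    refine Finset.sum_congr rfl fun i _ => ?_
    have hi : (i : ℕ) + 1 < ρ + 2 := by omega
    simp only [hi, dif_pos]
    rfl

end Telescoper

/-! ### Passage to the fraction field, and simplicity of the root -/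

/-- Localization is formally étale, so the Kähler differentials of `F` are those of `A` with scalars
extended to `F`. -/
theorem exists_derivation_fractionField {R A F : Type*} [CommRing R] [CommRing A] [Field F]
    [Algebra R A] [Algebra A F] [Algebra R F] [IsScalarTower R A F] [IsFractionRing A F]
    (D : Derivation R A A) : ∃ D' : Derivation R F F, ∀ x, D' (algebraMap A F x) = algebraMap A F (D x) := by
  have : Algebra.FormallyEtale A F :=
    Algebra.FormallyEtale.of_isLocalization (Rₘ := F) (nonZeroDivisors A)
  let ℓ := ((Algebra.linearMap A F).compDer D).liftKaehlerDifferential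
  refine ⟨((ℓ.liftBaseChange F) ∘ₗ (KaehlerDifferential.tensorKaehlerEquivOfFormallyEtale
    R A F).symm.toLinearMap).compDer (KaehlerDifferential.D R F), fun x => ?_⟩
  change ℓ.liftBaseChange F ((KaehlerDifferential.tensorKaehlerEquivOfFormallyEtale
    R A F).symm (KaehlerDifferential.D R F (algebraMap A F x))) = _
  rw [KaehlerDifferential.tensorKaehlerEquivOfFormallyEtale_symm_D_algebraMap,
    LinearMap.liftBaseChange_tmul, one_smul, Derivation.liftKaehlerDifferential_comp_D]
  rfl

/-- By Gauss's lemma `m` stays irreducible over the fraction field, hence separable in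
characteristic 0. Injectivity of `ψ` extends it to that field. -/
theorem eval₂_derivative_ne_zero_of_irreducible {A F : Type*} [CommRing A] [IsDomain A]
    [IsGCDMonoid A] [CharZero A] [Field F] {ψ : A →+* F} (hψ : Function.Injective ψ) {m : A[X]}
    (hm : Irreducible m) (hdeg : m.natDegree ≠ 0) {α : F} (h0 : m.eval₂ ψ α = 0) :
    (derivative m).eval₂ ψ α ≠ 0 := by
  have : CharZero (FractionRing A) := charZero_of_injective_algebraMap
    (IsFractionRing.injective A (FractionRing A))
  have hsep := (((hm.isPrimitive hdeg).irreducible_iff_irreducible_map_fraction_map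
    (K := FractionRing A)).1 hm).separable
  have hcomp : (IsFractionRing.lift hψ : FractionRing A →+* F).comp
      (algebraMap A (FractionRing A)) = ψ := RingHom.ext (IsFractionRing.lift_algebraMap hψ)
  have := hsep.eval₂_derivative_ne_zero (IsFractionRing.lift hψ : FractionRing A →+* F) (x := α)
    (by rw [eval₂_map, hcomp, h0])
  rwa [derivative_map, eval₂_map, hcomp] at this

theorem exists_last_ne_zero {M : Type*} [Zero M] {p : ℕ → M} {n : ℕ} (h : ∃ i ≤ n, p i ≠ 0) :
    ∃ k ≤ n, p k ≠ 0 ∧ ∀ i, k < i → i ≤ n → p i = 0 := by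
  classical
  obtain ⟨i, hi, hpi⟩ := h
  refine ⟨Nat.findGreatest (fun i => p i ≠ 0) n, Nat.findGreatest_le n,
    Nat.findGreatest_spec (P := fun i => p i ≠ 0) hi hpi, fun j hj hjn => ?_⟩
  simpa using Nat.findGreatest_is_greatest hj hjn

/-! ### Differential equations of exact order -/

namespace SatisfiesLinearODE

variable {K : Type*} [Field K] {a : K⟦X⟧} {r : ℕ} {d d' : ℝ}

theorem mono (h : SatisfiesLinearODE a r d) (hd : d ≤ d') : SatisfiesLinearODE a r d' := by
  obtain ⟨p, h0, h1, h2⟩ := h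
  exact ⟨p, h0, fun i hi => (h1 i hi).trans hd, h2⟩

/-- Differentiating the equation gives coefficients `pᵢ' + pᵢ₋₁`: the leading one is still `p_r` and
no degree grows. This repairs a telescoper whose top coefficient vanishes. -/
theorem succ (h : SatisfiesLinearODE a r d) : SatisfiesLinearODE a (r + 1) d := by
  obtain ⟨p, h0, h1, h2⟩ := h
  have hd : 0 ≤ d := (Nat.cast_nonneg _).trans (h1 0 (Nat.zero_le r))
  let p₁ : ℕ → K[X] := fun i => if i ≤ r then derivative (p i) else 0
  let p₂ : ℕ → K[X] := fun i => if i = 0 then 0 else p (i - 1)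
  refine ⟨fun i => p₁ i + p₂ i, by simpa [p₁, p₂] using h0, fun i hi => ?_, ?_⟩
  · have hp₁ : ((p₁ i).natDegree : ℝ) ≤ d := by
      simp only [p₁]
      split_ifs with hir
      · refine le_trans ?_ (h1 i hir)
        exact_mod_cast (natDegree_derivative_le (p i)).trans (Nat.sub_le _ _)
      · simpa using hd
    have hp₂ : ((p₂ i).natDegree : ℝ) ≤ d := by
      simp only [p₂]
      split_ifs with hir
      · simpa using hd
      · exact h1 _ (by omega)
    refine le_trans ?_ (max_le hp₁ hp₂)
    exact_mod_cast natDegree_add_le (p₁ i) (p₂ i)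
  · have h3 := congrArg (PowerSeries.derivative (R := K)) h2
    simp only [map_sum, map_zero, Derivation.leibniz, smul_eq_mul, PowerSeries.derivative_coe,
      Finset.sum_add_distrib, ← Function.iterate_succ_apply'] at h3
    simp only [Polynomial.coe_add, add_mul, Finset.sum_add_distrib]
    rw [← h3, add_comm]
    congr 1
    · rw [Finset.sum_range_succ']
      simp [p₂]
    · rw [Finset.sum_range_succ]
      simp only [p₁, if_neg (Nat.not_succ_le_self r), Polynomial.coe_zero, zero_mul, add_zero]
      refine Finset.sum_congr rfl fun i hi => ?_
      rw [if_pos (by simpa [Nat.lt_succ_iff] using hi), mul_comm]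

theorem of_le {s : ℕ} (h : SatisfiesLinearODE a r d) (hs : r ≤ s) : SatisfiesLinearODE a s d := by
  induction s, hs using Nat.le_induction with
  | base => exact h
  | succ s _ ih => exact ih.succ

theorem of_exists_ne_zero {p : ℕ → K[X]} (h0 : ∃ i ≤ r, p i ≠ 0)
    (h1 : ∀ i ≤ r, ((p i).natDegree : ℝ) ≤ d)
    (h2 : ∑ i ∈ Finset.range (r + 1),
      (p i : K⟦X⟧) * (PowerSeries.derivative (R := K))^[i] a = 0) :
    SatisfiesLinearODE a r d := by
  obtain ⟨k, hk, hpk, hp⟩ := exists_last_ne_zero h0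
  refine of_le ⟨p, hpk, fun i hi => h1 i (hi.trans hk), ?_⟩ hk
  rw [← h2]
  refine Finset.sum_subset (Finset.range_mono (by omega)) fun i hi hi' => ?_
  rw [Finset.mem_range] at hi hi'
  rw [hp i (by omega) (by omega), Polynomial.coe_zero, zero_mul]

end SatisfiesLinearODE

theorem sum_iterate_derivative_eq_zero_of_telescoper {K : Type*} (F : Type*) [Field K] [CharZero K]
    [Field F] [Algebra K⟦X⟧ F] [Algebra K F] [IsScalarTower K K⟦X⟧ F] [IsFractionRing K⟦X⟧ F]
    {m : K[X][X]} (hm : Irreducible m) (hy : m.natDegree ≠ 0) {a : K⟦X⟧} (ha : IsSeriesRoot m a)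
    (ρ : ℕ) (p : ℕ → K[X]) (G : K[X][X])
    (hG : C (p 0) * (X * derivative m * m ^ ρ) +
      ∑ i ∈ Finset.range (ρ + 1), C (p (i + 1)) * (derivNumerator m i * m ^ (ρ - i)) +
      (derivative G * m - (ρ : K[X][X]) * G * derivative m) = 0) :
    ∑ i ∈ Finset.range (ρ + 2), (p i : K⟦X⟧) * (PowerSeries.derivative (R := K))^[i] a = 0 := by
  obtain ⟨D', hD'⟩ := exists_derivation_fractionField (F := F) (PowerSeries.derivative (R := K))
  let D : Derivation ℤ F F := D'.restrictScalars ℤ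
  have hD : ∀ f, D (algebraMap K⟦X⟧ F f) = algebraMap K⟦X⟧ F (PowerSeries.derivative (R := K) f) :=
    hD'
  have hinj : Function.Injective (algebraMap K⟦X⟧ F) := IsFractionRing.injective _ _
  let ψ : K[X] →+* F := (algebraMap K⟦X⟧ F).comp coeToPowerSeries.ringHom
  have hψ : Function.Injective ψ := hinj.comp (Polynomial.coe_injective K)
  have hDψ : ∀ q, D (ψ q) = ψ (derivative q) := fun q => by
    simp only [ψ, RingHom.comp_apply, hD, coeToPowerSeries.ringHom_apply,
      PowerSeries.derivative_coe]
  have h0 : m.eval₂ ψ (algebraMap K⟦X⟧ F a) = 0 := by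
    rw [← hom_eval₂, ha, map_zero]
  have h1 := eval₂_derivative_ne_zero_of_irreducible hψ hm hy h0
  have key := sum_iterate_eq_zero_of_telescoper hDψ h0 h1 ρ p G hG
  have hiter : ∀ i, D^[i] (algebraMap K⟦X⟧ F a) =
      algebraMap K⟦X⟧ F ((PowerSeries.derivative (R := K))^[i] a) := by
    intro i
    induction i with
    | zero => rfl
    | succ i ih => rw [Function.iterate_succ_apply', ih, hD, Function.iterate_succ_apply']
  apply hinj
  rw [map_zero, ← key, map_sum]
  refine Finset.sum_congr rfl fun i _ => ?_
  rw [map_mul, hiter]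
  rfl

/-- The order-degree curve for the differential equations of an algebraic power series. -/
theorem satisfiesLinearODE_of_isSeriesRoot {K : Type*} [Field K] [CharZero K] {m : K[X][X]}
    (hm : Irreducible m) {τx τy : ℕ} (hτx : τx = degX m) (hτy : τy = m.natDegree) (hy : 0 < τy)
    {a : K⟦X⟧} (ha : IsSeriesRoot m a) {r d : ℕ} (hr : τy ≤ r) (hd : τy ≤ d)
    (hcount : 2 * τx * (τy * (2 * r - 1) + 1) < 2 * (r + 1 - τy) * (d + 1) + τy * (τy - 1)) :
    SatisfiesLinearODE a r d := by
  obtain ⟨ρ, rfl⟩ := Nat.exists_eq_add_of_le' (hy.trans_le hr)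
  rw [show 2 * (ρ + 1) - 1 = 2 * ρ + 1 by omega] at hcount
  obtain ⟨p, G, hp0, hpd, hp⟩ := exists_telescoper hτx hτy hm.ne_zero hr hd hcount
  exact SatisfiesLinearODE.of_exists_ne_zero hp0 (fun i hi => Nat.cast_le.2 (hpd i hi))
    (sum_iterate_derivative_eq_zero_of_telescoper (FractionRing K⟦X⟧) hm (by omega) ha ρ p G hp)

/-! ### From differential equations to recurrences -/

namespace SatisfiesLinearRecurrence

variable {K : Type*} [Field K] {u : ℕ → K} {s : ℕ} {d : ℝ}

theorem succ (h : SatisfiesLinearRecurrence u s d) : SatisfiesLinearRecurrence u (s + 1) d := by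
  obtain ⟨q, h0, h1, h2⟩ := h
  refine ⟨fun k => if k = 0 then 0 else (q (k - 1)).comp (X + C 1), ?_, fun k hk => ?_,
    fun n => ?_⟩
  · dsimp only
    rw [if_neg (Nat.succ_ne_zero s), Nat.add_sub_cancel, ← taylor_apply]
    exact (map_ne_zero_iff _ (taylor_injective 1)).2 h0
  · dsimp only
    split_ifs with hk0
    · simpa using (Nat.cast_nonneg _).trans (h1 0 (Nat.zero_le s))
    · rw [natDegree_comp, natDegree_X_add_C, mul_one]
      exact h1 _ (by omega)
  · rw [Finset.sum_range_succ', ← h2 (n + 1)]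
    simp only [if_true, eval_zero, zero_mul, add_zero]
    refine Finset.sum_congr rfl fun k _ => ?_
    rw [if_neg (Nat.succ_ne_zero k), Nat.add_sub_cancel, eval_comp, eval_add, eval_X, eval_C,
      Nat.cast_add, Nat.cast_one, show n + (k + 1) = n + 1 + k by omega]

theorem of_le {t : ℕ} (h : SatisfiesLinearRecurrence u s d) (ht : s ≤ t) :
    SatisfiesLinearRecurrence u t d := by
  induction t, ht using Nat.le_induction with
  | base => exact h
  | succ s _ ih => exact ih.succ

theorem of_exists_ne_zero {q : ℕ → K[X]} (h0 : ∃ k ≤ s, q k ≠ 0)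
    (h1 : ∀ k ≤ s, ((q k).natDegree : ℝ) ≤ d)
    (h2 : ∀ n : ℕ, ∑ k ∈ Finset.range (s + 1), (q k).eval (n : K) * u (n + k) = 0) :
    SatisfiesLinearRecurrence u s d := by
  obtain ⟨k, hk, hqk, hq⟩ := exists_last_ne_zero h0
  refine of_le ⟨q, hqk, fun i hi => h1 i (hi.trans hk), fun n => ?_⟩ hk
  rw [← h2 n]
  refine Finset.sum_subset (Finset.range_mono (by omega)) fun i hi hi' => ?_
  rw [Finset.mem_range] at hi hi'
  rw [hq i (by omega) (by omega), eval_zero, zero_mul]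

end SatisfiesLinearRecurrence

/-- The coefficient of the `k`-th shift in the recurrence obtained from `∑ pᵢ Dⁱ` by comparing
coefficients of `x ^ (n + d)`. -/
noncomputable def recurrenceCoeff {K : Type*} [Field K] (p : ℕ → K[X]) (r d k : ℕ) : K[X] :=
  ∑ i ∈ Finset.range (r + 1), ∑ j ∈ Finset.range (d + 1),
    if d - j + i = k then C ((p i).coeff j) * (ascPochhammer K i).comp (X + C ((d - j + 1 : ℕ) : K))
    else 0

theorem coeff_add_coe_mul {K : Type*} [Field K] {p : K[X]} {d : ℕ} (hp : p.natDegree ≤ d)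
    (f : K⟦X⟧) (n : ℕ) : PowerSeries.coeff (n + d) ((p : K⟦X⟧) * f) =
      ∑ j ∈ Finset.range (d + 1), p.coeff j * PowerSeries.coeff (n + (d - j)) f := by
  rw [PowerSeries.coeff_mul, Finset.Nat.sum_antidiagonal_eq_sum_range_succ
    (f := fun i j => PowerSeries.coeff i (p : K⟦X⟧) * PowerSeries.coeff j f)]
  symm
  refine (Finset.sum_congr rfl fun j hj => ?_).trans
    (Finset.sum_subset (Finset.range_mono (by omega : d + 1 ≤ (n + d).succ)) fun j _ hj => ?_)
  · rw [Finset.mem_range] at hj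
    rw [Polynomial.coeff_coe, show n + d - j = n + (d - j) by omega]
  · rw [Finset.mem_range] at hj
    rw [Polynomial.coeff_coe, coeff_eq_zero_of_natDegree_lt (by omega), zero_mul]

theorem SatisfiesLinearODE.satisfiesLinearRecurrence {K : Type*} [Field K] {a : K⟦X⟧} {r d : ℕ}
    (h : SatisfiesLinearODE a r d) :
    SatisfiesLinearRecurrence (fun n => PowerSeries.coeff n a) (r + d) r := by
  obtain ⟨p, h0, h1, h2⟩ := h
  have hdeg : ∀ i t, ((ascPochhammer K i).comp (X + C (t : K))).natDegree = i := fun i t => by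
    rw [natDegree_comp, natDegree_X_add_C, mul_one, ascPochhammer_natDegree]
  refine SatisfiesLinearRecurrence.of_exists_ne_zero (q := recurrenceCoeff p r d) ?_
    (fun k hk => Nat.cast_le.2 ?_) fun n => ?_
  · obtain ⟨j, hj⟩ : ∃ j, (p r).coeff j ≠ 0 := by
      by_contra! hj
      exact h0 (Polynomial.ext hj)
    have hjd : j ≤ d := (le_natDegree_of_ne_zero hj).trans (Nat.cast_le.1 (h1 r le_rfl))
    -- At this shift the coefficient of `n ^ r` is exactly `(p r).coeff j`: terms with `i < r` have
    -- degree `i` in `n`, and for `i = r` only this `j` contributes.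
    refine ⟨d - j + r, by omega, fun hq => hj ?_⟩
    have hc := congrArg (fun q => Polynomial.coeff q r) hq
    simp only [recurrenceCoeff, finsetSum_coeff, coeff_zero] at hc
    rw [Finset.sum_range_succ, Finset.sum_eq_zero, zero_add,
      Finset.sum_eq_single_of_mem j (Finset.mem_range.2 (by omega)), if_pos rfl, coeff_C_mul] at hc
    · have hmonic : ((ascPochhammer K r).comp (X + C ((d - j + 1 : ℕ) : K))).Monic :=
        (monic_ascPochhammer K r).comp_X_add_C _
      have hlead := hmonic.coeff_natDegree
      rw [hdeg] at hlead
      rwa [hlead, mul_one] at hc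
    · intro j' hj' hne
      rw [Finset.mem_range] at hj'
      rw [if_neg (by omega), coeff_zero]
    · intro i hi
      rw [Finset.mem_range] at hi
      refine Finset.sum_eq_zero fun j' _ => ?_
      split_ifs
      · rw [coeff_C_mul]
        exact mul_eq_zero_of_right _ (coeff_eq_zero_of_natDegree_lt (by rw [hdeg]; exact hi))
      · exact coeff_zero _
  · refine natDegree_sum_le_of_forall_le _ _ fun i hi => natDegree_sum_le_of_forall_le _ _
      fun j _ => ?_
    rw [Finset.mem_range] at hi
    split_ifs
    · refine (natDegree_C_mul_le _ _).trans ?_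
      rw [hdeg]
      omega
    · simp
  · have h3 := congrArg (PowerSeries.coeff (n + d)) h2
    rw [map_sum, map_zero] at h3
    rw [← h3]
    simp only [recurrenceCoeff, eval_finsetSum, Finset.sum_mul]
    rw [Finset.sum_comm]
    refine Finset.sum_congr rfl fun i hi => ?_
    rw [Finset.mem_range] at hi
    rw [coeff_add_coe_mul (Nat.cast_le.1 (h1 i (by omega))), Finset.sum_comm]
    refine Finset.sum_congr rfl fun j hj => ?_
    rw [Finset.mem_range] at hj
    rw [Finset.sum_eq_single_of_mem (d - j + i) (Finset.mem_range.2 (by omega)), if_pos rfl,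
      PowerSeries.coeff_iterate_derivative, Nat.cast_ascFactorial]
    · simp [add_assoc, mul_assoc]
    · intro k _ hk
      rw [if_neg hk.symm, eval_zero, zero_mul]

/-! ### Choosing points on the order-degree curve -/

theorem satisfiesLinearODE_of_isSeriesRoot_of_lt {K : Type*} [Field K] [CharZero K] {m : K[X][X]}
    (hm : Irreducible m) {τx τy : ℕ} (hτx : τx = degX m) (hτy : τy = m.natDegree) (hy : 0 < τy)
    {a : K⟦X⟧} (ha : IsSeriesRoot m a) {r d : ℕ} (hr : τy ≤ r) (hd : τy ≤ d)
    (hcount : (2 * τx * (τy * (2 * r - 1) + 1) : ℝ) <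
      2 * (r + 1 - τy) * (d + 1) + τy * (τy - 1)) :
    SatisfiesLinearODE a r d := by
  refine satisfiesLinearODE_of_isSeriesRoot hm hτx hτy hy ha hr hd ?_
  rw [← Nat.cast_lt (α := ℝ)]
  push_cast [Nat.cast_sub (show 1 ≤ 2 * r by omega), Nat.cast_sub (show τy ≤ r + 1 by omega),
    Nat.cast_sub (show 1 ≤ τy from hy)]
  exact hcount

theorem mainTheorem4 {K : Type*} [Field K] [CharZero K]
    (m : K[X][X]) (hm : Irreducible m)
    (τx τy : ℕ) (hτx : τx = degX m) (hτy : τy = m.natDegree)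
    (hx : 0 < τx) (hy : 0 < τy)
    (a : K⟦X⟧) (ha : IsSeriesRoot m a) :
    SatisfiesLinearODE a τy
      (2 * τx * τy ^ 2 - 1 / 2 * τy ^ 2 + τx * τy - 3 / 2 * τy + τx + 3 : ℝ) ∧
    SatisfiesLinearODE a (2 * τy)
      (4 * τx * τy - 1 / 2 * τy - 3 * τx - 1 +
        (⌈(4 * ((τx + 1) / (τy + 1)) : ℝ)⌉ : ℝ) : ℝ) ∧
    SatisfiesLinearRecurrence (fun n => PowerSeries.coeff n a)
      ⌈(2 * τx * τy + τy - 1 +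
        √((8 * τy ^ 2 - 4 * τy + 4) * τx - 2 * τy ^ 2 - 6 * τy + 12) : ℝ)⌉₊
      (⌈(τy - 1 + 1 / 2 *
        √((8 * τy ^ 2 - 4 * τy + 4) * τx - 2 * τy ^ 2 - 6 * τy + 12) : ℝ)⌉₊ : ℝ) := by
  have ht : (1 : ℝ) ≤ τx := by exact_mod_cast hx
  have hu : (1 : ℝ) ≤ τy := by exact_mod_cast hy
  have htu : (0 : ℝ) ≤ (τx - 1) * τy := mul_nonneg (by linarith) (by linarith)
  have htuu : (0 : ℝ) ≤ (τx - 1) * τy ^ 2 := mul_nonneg (by linarith) (by positivity)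
  have huu : (0 : ℝ) ≤ (τy - 1) ^ 2 := sq_nonneg _
  refine ⟨?_, ?_, ?_⟩
  · generalize hV : (2 * τx * τy ^ 2 - 1 / 2 * τy ^ 2 + τx * τy - 3 / 2 * τy + τx + 3 : ℝ) = V
    have hVy : (τy : ℝ) ≤ V := by nlinarith
    -- With `d = ⌊V⌋`, the count needs only `d + 1` to exceed a bound lying `2 τx τy - 2 τy + 3 > 0`
    -- below `V`.
    have hfloor := Nat.lt_floor_add_one V
    refine (satisfiesLinearODE_of_isSeriesRoot_of_lt hm hτx hτy hy ha le_rfl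
      (Nat.le_floor hVy) ?_).mono (Nat.floor_le (by linarith))
    nlinarith
  · have hc := Int.le_ceil (4 * ((τx + 1) / (τy + 1)) : ℝ)
    generalize (⌈(4 * ((τx + 1) / (τy + 1)) : ℝ)⌉ : ℝ) = c at *
    have hc' : (4 * (τx + 1) : ℝ) ≤ c * (τy + 1) := by
      rwa [← mul_div_assoc, div_le_iff₀ (by linarith)] at hc
    generalize hV : (4 * τx * τy - 1 / 2 * τy - 3 * τx - 1 + c : ℝ) = V
    have hVy : (τy : ℝ) ≤ V := by
      -- For `τy ≥ 2` the bound `c ≥ 0` suffices; for `τy = 1` the actual size `c ≥ 2 (τx + 1)` is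
      -- needed.
      rcases Nat.lt_or_ge 1 τy with h2 | h2
      · have h2' : (2 : ℝ) ≤ τy := by exact_mod_cast h2
        have hc0 : 0 ≤ c := le_trans (by positivity) hc
        nlinarith
      · have h2' : (τy : ℝ) = 1 := by exact_mod_cast le_antisymm h2 hy
        rw [h2'] at hc' hV ⊢
        linarith
    have hfloor := Nat.lt_floor_add_one V
    refine (satisfiesLinearODE_of_isSeriesRoot_of_lt hm hτx hτy hy ha (by omega)
      (Nat.le_floor hVy) ?_).mono (Nat.floor_le (by linarith))
    have h1 : (τy + 1) * V < (τy + 1) * (⌊V⌋₊ + 1 : ℝ) := by gcongr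
    rw [← hV] at h1
    push_cast
    rw [← hV]
    nlinarith
  · have hB : (0 : ℝ) < (8 * τy ^ 2 - 4 * τy + 4) * τx - 2 * τy ^ 2 - 6 * τy + 12 := by nlinarith
    have hR := Real.sqrt_pos.2 hB
    have hRsq := Real.sq_sqrt hB.le
    generalize √((8 * τy ^ 2 - 4 * τy + 4) * τx - 2 * τy ^ 2 - 6 * τy + 12 : ℝ) = R at *
    have hr1 := Nat.le_ceil (τy - 1 + 1 / 2 * R : ℝ)
    have hr2 := Nat.ceil_lt_add_one (show (0 : ℝ) ≤ τy - 1 + 1 / 2 * R by linarith)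
    have hS := Nat.le_ceil (2 * τx * τy + τy - 1 + R : ℝ)
    generalize ⌈(τy - 1 + 1 / 2 * R : ℝ)⌉₊ = r at *
    generalize ⌈(2 * τx * τy + τy - 1 + R : ℝ)⌉₊ = S at *
    have hr : τy ≤ r := by
      have : (τy : ℝ) < (r + 1 : ℕ) := by push_cast; linarith
      exact Nat.lt_succ_iff.1 (by exact_mod_cast this)
    obtain ⟨d, rfl⟩ : ∃ d, S = r + d := by
      refine Nat.exists_eq_add_of_le ?_
      rw [← Nat.cast_le (α := ℝ)]
      linarith
    push_cast at hS
    refine (satisfiesLinearODE_of_isSeriesRoot_of_lt hm hτx hτy hy ha hr ?_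
      ?_).satisfiesLinearRecurrence
    · rw [← Nat.cast_le (α := ℝ)]
      linarith
    · have hs : (0 : ℝ) ≤ r + 1 - τy := by linarith
      have h1 := mul_le_mul_of_nonneg_left hS hs
      -- With `s = r + 1 - τy`, the product `s (R - s)` equals `R ^ 2 / 4 - (s - R / 2) ^ 2`.
      -- Rounding `r` up therefore costs less than 1, which the slack in `R ^ 2` absorbs.
      have h2 : (r + 1 - τy - 1 / 2 * R : ℝ) ^ 2 < 1 := by
        rw [sq_lt_one_iff_abs_lt_one, abs_lt]
        constructor <;> linarith
      nlinarith
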